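/- Let $G$ be a discrete group, let $\lambda$ be its left regular representation on $\ell^2(G)$, and let $A(G)$ be the Fourier algebra of $G$, that is, the Banach algebra, under pointwise operations, of all functions $f\colon G\to\mathbb{C}$ of the form $f(t)=\sum_{n}\langle \lambda(t)\xi_n,\eta_n\rangle$ $(t\in G)$ with $\xi_n,\eta_n\in\ell^2(G)$ and $\sum_n\|\xi_n\|\|\eta_n\|<\infty$, where $\|f\|$ is the infimum of $\sum_n\|\xi_n\|\|\eta_n\|$ over all such expressions of $f$. Suppose that $f\in\overline{A(G)f}$ for every $f\in A(G)$, where $A(G)f=\{af : a\in A(G)\}$ and the closure is in the norm of $A(G)$. Then the following are equivalent: (a) $A(G)$ is topologically Noetherian, that is, for every norm-closed ideal $I$ of $A(G)$ there are $n\in\mathbb{N}$ and $x_1,\dots,x_n\in I$ with $I=\overline{A(G)^\sharp x_1+\cdots+A(G)^\sharp x_n}$, where $A(G)^\sharp x=\mathbb{C}x+A(G)x$; (b) $G$ is countable (finite or countably infinite). -/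

import Mathlib

open scoped InnerProductSpace

/-- The Hilbert space `ℓ²(G)`. -/
abbrev EllTwo (G : Type*) : Type _ := lp (fun _ : G => ℂ) 2

theorem EllTwo.hasSum_norm_sq {G : Type*} (ξ : EllTwo G) :
    HasSum (fun s => ‖ξ s‖ ^ 2) (‖ξ‖ ^ 2) := by
  have h := lp.hasSum_norm (p := 2) (by norm_num) ξ
  simpa using h

theorem EllTwo.mem_of_summable {G : Type*} {f : G → ℂ} (hf : Summable fun s => ‖f s‖ ^ 2) :
    Memℓp f 2 := by
  apply memℓp_gen
  simpa using hf

theorem EllTwo.summable_translate {G : Type*} [Group G] (t : G) (ξ : EllTwo G) :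
    Summable fun s => ‖ξ (t⁻¹ * s)‖ ^ 2 := by
  have h := (Equiv.mulLeft t⁻¹).summable_iff.mpr ξ.hasSum_norm_sq.summable
  exact h

/-- The left regular representation of the discrete group `G` on `ℓ²(G)`:
`(λ(t) ξ)(s) = ξ(t⁻¹ s)`. Each `λ(t)` is a surjective linear isometry, that is, a unitary. -/
noncomputable def leftRegular (G : Type*) [Group G] : G →* (EllTwo G ≃ₗᵢ[ℂ] EllTwo G) where
  toFun t :=
    { toFun := fun ξ => ⟨fun s => ξ (t⁻¹ * s), EllTwo.mem_of_summable (ξ.summable_translate t)⟩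
      invFun := fun ξ => ⟨fun s => ξ (t⁻¹⁻¹ * s),
        EllTwo.mem_of_summable (ξ.summable_translate t⁻¹)⟩
      map_add' := fun _ _ => rfl
      map_smul' := fun _ _ => rfl
      left_inv := fun ξ => by ext s; simp
      right_inv := fun ξ => by ext s; simp
      norm_map' := fun ξ => by
        have h1 := (Equiv.mulLeft t⁻¹).hasSum_iff.mpr ξ.hasSum_norm_sq
        have h2 := EllTwo.hasSum_norm_sq (G := G)
          ⟨fun s => ξ (t⁻¹ * s), EllTwo.mem_of_summable (ξ.summable_translate t)⟩
        exact (sq_eq_sq₀ (norm_nonneg _) (norm_nonneg _)).mp (h2.unique h1) }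
  map_one' := by ext ξ s; simp
  map_mul' t u := LinearIsometryEquiv.ext fun ξ => by
    ext s
    change ξ ((t * u)⁻¹ * s) = ξ (u⁻¹ * (t⁻¹ * s))
    rw [mul_inv_rev, mul_assoc]

theorem leftRegular_apply {G : Type*} [Group G] (t : G) (ξ : EllTwo G) (s : G) :
    leftRegular G t ξ s = ξ (t⁻¹ * s) := rfl

/-- `FourierBound f C` says that `f` is an absolutely convergent sum of coefficient functions of the
left regular representation, `f(t) = ∑ₙ ⟨λ(t) ξₙ, ηₙ⟩` for all `t`, with `∑ₙ ‖ξₙ‖ ‖ηₙ‖ = C`.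
(Mathlib's inner product is linear in the second variable.) -/
def FourierBound {G : Type*} [Group G] (f : G → ℂ) (C : ℝ) : Prop :=
  ∃ ξ η : ℕ → EllTwo G, HasSum (fun n => ‖ξ n‖ * ‖η n‖) C ∧
    ∀ t, HasSum (fun n => ⟪η n, leftRegular G t (ξ n)⟫_ℂ) (f t)

namespace FourierBound

variable {G : Type*} [Group G] {f g : G → ℂ} {C D : ℝ}

theorem of_index {ι : Type*} (ξ η : ι → EllTwo G)
    (hC : HasSum (fun i => ‖ξ i‖ * ‖η i‖) C)
    (hf : ∀ t, HasSum (fun i => ⟪η i, leftRegular G t (ξ i)⟫_ℂ) (f t)) : FourierBound f C := by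
  classical
  set S : Set ι := Function.support (fun i => ‖ξ i‖ * ‖η i‖) with hS
  have hcount : S.Countable := hC.summable.countable_support
  have : Countable S := hcount
  obtain ⟨e, he⟩ := exists_injective_nat S
  have hext : ∀ (φ : ι → EllTwo G) (n : ℕ), (n ∈ Set.range e → False) →
      Function.extend e (fun i : S => φ i) 0 n = 0 := by
    intro φ n hn
    rw [Function.extend_apply' _ _ _ (fun h => hn h)]; rfl
  refine ⟨Function.extend e (fun i : S => ξ i) 0, Function.extend e (fun i : S => η i) 0, ?_, ?_⟩
  · rw [← he.hasSum_iff (fun n hn => by simp [hext _ n hn])]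
    have : HasSum ((fun i => ‖ξ i‖ * ‖η i‖) ∘ ((↑) : S → ι)) C :=
      (hasSum_subtype_iff_of_support_subset subset_rfl).mpr hC
    convert! this using 1
    funext i
    simp [he.extend_apply]
  · intro t
    rw [← he.hasSum_iff (fun n hn => by simp [hext _ n hn])]
    have : HasSum ((fun i => ⟪η i, leftRegular G t (ξ i)⟫_ℂ) ∘ ((↑) : S → ι)) (f t) := by
      refine (hasSum_subtype_iff_of_support_subset ?_).mpr (hf t)
      intro i hi
      simp only [hS, Function.mem_support, ne_eq] at hi ⊢
      contrapose! hi
      rcases mul_eq_zero.mp hi with h | h <;> simp [norm_eq_zero.mp h]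
    convert! this using 1
    funext i
    simp [he.extend_apply]

theorem nonneg (h : FourierBound f C) : 0 ≤ C := by
  obtain ⟨ξ, η, hC, -⟩ := h
  exact hC.nonneg fun n => by positivity

theorem norm_apply_le (h : FourierBound f C) (t : G) : ‖f t‖ ≤ C := by
  obtain ⟨ξ, η, hC, hf⟩ := h
  refine (hf t).norm_le_of_bounded hC fun n => ?_
  refine (norm_inner_le_norm _ _).trans ?_
  rw [LinearIsometryEquiv.norm_map, mul_comm]

theorem zero : FourierBound (0 : G → ℂ) 0 :=
  ⟨0, 0, by simp, fun t => by simp⟩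

theorem add (hf : FourierBound f C) (hg : FourierBound g D) : FourierBound (f + g) (C + D) := by
  obtain ⟨ξ, η, hC, hf⟩ := hf
  obtain ⟨ξ', η', hD, hg⟩ := hg
  exact of_index (Sum.elim ξ ξ') (Sum.elim η η') (HasSum.sum hC hD)
    (fun t => HasSum.sum (hf t) (hg t))

theorem smul (c : ℂ) (hf : FourierBound f C) : FourierBound (c • f) (‖c‖ * C) := by
  obtain ⟨ξ, η, hC, hf⟩ := hf
  refine ⟨fun n => c • ξ n, η, ?_, fun t => ?_⟩
  · simpa [norm_smul, mul_assoc] using hC.mul_left ‖c‖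
  · simpa [inner_smul_right] using (hf t).mul_left c

theorem hasSum_shear {R : Type*} [NormedRing R] [CompleteSpace R] {a b : G → R} {x y : R}
    (ha : HasSum a x) (hb : HasSum b y) (ha' : Summable fun s => ‖a s‖)
    (hb' : Summable fun s => ‖b s‖) :
    HasSum (fun p : G × G => a p.2 * b (p.2 * p.1)) (x * y) := by
  have h := ha.mul hb (summable_mul_of_summable_norm ha' hb')
  let e : G × G ≃ G × G :=
    { toFun := fun p => (p.2, p.2 * p.1)
      invFun := fun q => (q.1⁻¹ * q.2, q.1)
      left_inv := fun p => by simp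
      right_inv := fun q => by simp }
  have h2 := e.hasSum_iff.mpr h
  exact h2

theorem hasSum_twist_sq (ξ ξ' : EllTwo G) :
    HasSum (fun p : G × G => ‖ξ p.2 * ξ' (p.2 * p.1)‖ ^ 2) ((‖ξ‖ * ‖ξ'‖) ^ 2) := by
  have h := hasSum_shear ξ.hasSum_norm_sq ξ'.hasSum_norm_sq
    ξ.hasSum_norm_sq.summable.norm ξ'.hasSum_norm_sq.summable.norm
  simpa only [mul_pow, norm_mul] using h

theorem hasSum_twist_inner (ξ ξ' η η' : EllTwo G) :
    HasSum (fun p : G × G => ⟪η p.2, ξ p.2⟫_ℂ * ⟪η' (p.2 * p.1), ξ' (p.2 * p.1)⟫_ℂ)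
      (⟪η, ξ⟫_ℂ * ⟪η', ξ'⟫_ℂ) := by
  have h1 : HasSum (fun s => ⟪η s, ξ s⟫_ℂ) ⟪η, ξ⟫_ℂ := lp.hasSum_inner η ξ
  have h2 : HasSum (fun s => ⟪η' s, ξ' s⟫_ℂ) ⟪η', ξ'⟫_ℂ := lp.hasSum_inner η' ξ'
  have h3 := hasSum_shear h1 h2 h1.summable.norm h2.summable.norm
  exact h3

/-- The vector `s ↦ ξ(s) ξ'(s u)`. -/
noncomputable def twist (ξ ξ' : EllTwo G) (u : G) : EllTwo G :=
  ⟨fun s => ξ s * ξ' (s * u),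
    EllTwo.mem_of_summable ((hasSum_twist_sq ξ ξ').summable.prod_factor u)⟩

theorem twist_apply (ξ ξ' : EllTwo G) (u s : G) : twist ξ ξ' u s = ξ s * ξ' (s * u) := rfl

theorem hasSum_norm_twist (ξ ξ' : EllTwo G) :
    HasSum (fun u => ‖twist ξ ξ' u‖ ^ 2) ((‖ξ‖ * ‖ξ'‖) ^ 2) :=
  (hasSum_twist_sq ξ ξ').prod_fiberwise fun u => (twist ξ ξ' u).hasSum_norm_sq

theorem leftRegular_twist (ξ ξ' : EllTwo G) (t u : G) :
    leftRegular G t (twist ξ ξ' u) = twist (leftRegular G t ξ) (leftRegular G t ξ') u := by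
  ext s
  simp only [leftRegular_apply, twist_apply, mul_assoc]

theorem hasSum_inner_twist (ξ ξ' η η' : EllTwo G) (t : G) :
    HasSum (fun u => ⟪twist η η' u, leftRegular G t (twist ξ ξ' u)⟫_ℂ)
      (⟪η, leftRegular G t ξ⟫_ℂ * ⟪η', leftRegular G t ξ'⟫_ℂ) := by
  simp only [leftRegular_twist]
  refine (hasSum_twist_inner (leftRegular G t ξ) (leftRegular G t ξ') η η').prod_fiberwise
    fun u => ?_
  have h := lp.hasSum_inner (𝕜 := ℂ) (twist η η' u)
    (twist (leftRegular G t ξ) (leftRegular G t ξ') u)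
  have he : (fun s => ⟪twist η η' u s,
      twist (leftRegular G t ξ) (leftRegular G t ξ') u s⟫_ℂ) = fun s =>
      ⟪η s, leftRegular G t ξ s⟫_ℂ * ⟪η' (s * u), leftRegular G t ξ' (s * u)⟫_ℂ := by
    funext s
    simp only [twist_apply, RCLike.inner_apply, map_mul]
    ring
  rwa [he] at h

theorem summable_norm_twist (ξ ξ' η η' : EllTwo G) :
    (Summable fun u => ‖twist ξ ξ' u‖ * ‖twist η η' u‖) ∧
      ∑' u, ‖twist ξ ξ' u‖ * ‖twist η η' u‖ ≤ (‖ξ‖ * ‖η‖) * (‖ξ'‖ * ‖η'‖) := by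
  have h1 := hasSum_norm_twist ξ ξ'
  have h2 := hasSum_norm_twist η η'
  have h := Real.summable_and_inner_le_Lp_mul_Lq_tsum_of_nonneg Real.HolderConjugate.two_two
    (f := fun u => ‖twist ξ ξ' u‖) (g := fun u => ‖twist η η' u‖)
    (fun u => norm_nonneg _) (fun u => norm_nonneg _)
    (by simpa using h1.summable) (by simpa using h2.summable)
  refine ⟨h.1, h.2.trans (le_of_eq ?_)⟩
  simp only [Real.rpow_ofNat]
  rw [h1.tsum_eq, h2.tsum_eq, ← Real.sqrt_eq_rpow, ← Real.sqrt_eq_rpow,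
    Real.sqrt_sq (by positivity), Real.sqrt_sq (by positivity)]
  ring

theorem summable_fiber {κ ι : Type*} {F : κ × ι → ℝ} (hF : ∀ p, 0 ≤ F p) {b : κ → ℝ} {x : ℝ}
    (hfib : ∀ p, (Summable fun u => F (p, u)) ∧ ∑' u, F (p, u) ≤ b p) (hb : HasSum b x) :
    Summable F ∧ ∑' p, F p ≤ x := by
  have hs : Summable F := by
    refine (summable_prod_of_nonneg hF).mpr ⟨fun p => (hfib p).1, ?_⟩
    exact hb.summable.of_nonneg_of_le (fun p => tsum_nonneg fun u => hF _) (fun p => (hfib p).2)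
  exact ⟨hs, hasSum_le (fun p => (hfib p).2)
    (hs.hasSum.prod_fiberwise fun p => (hfib p).1.hasSum) hb⟩

theorem hasSum_fiber {κ ι : Type*} {F : κ × ι → ℂ} (hF : Summable F) {b : κ → ℂ} {x : ℂ}
    (hfib : ∀ p, HasSum (fun u => F (p, u)) (b p)) (hb : HasSum b x) : HasSum F x := by
  rw [← (hF.hasSum.prod_fiberwise hfib).unique hb]
  exact hF.hasSum

theorem norm_coeff_le (ξ η : EllTwo G) (t : G) :
    ‖⟪η, leftRegular G t ξ⟫_ℂ‖ ≤ ‖ξ‖ * ‖η‖ := by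
  refine (norm_inner_le_norm _ _).trans ?_
  rw [LinearIsometryEquiv.norm_map, mul_comm]

theorem hasSum_mul_coeff {ι κ : Type*} {a : ι → ℂ} {b : κ → ℂ} {x y : ℂ} {p : ι → ℝ} {q : κ → ℝ}
    (ha : HasSum a x) (hb : HasSum b y) (hp : Summable p) (hq : Summable q)
    (hap : ∀ i, ‖a i‖ ≤ p i) (hbq : ∀ i, ‖b i‖ ≤ q i) :
    HasSum (fun i : ι × κ => a i.1 * b i.2) (x * y) :=
  ha.mul hb (summable_mul_of_summable_norm (hp.of_nonneg_of_le (fun _ => norm_nonneg _) hap)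
    (hq.of_nonneg_of_le (fun _ => norm_nonneg _) hbq))

theorem mul (hf : FourierBound f C) (hg : FourierBound g D) :
    ∃ E, E ≤ C * D ∧ FourierBound (f * g) E := by
  obtain ⟨ξ, η, hC, hf⟩ := hf
  obtain ⟨ξ', η', hD, hg⟩ := hg
  have hCD := hC.mul hD (hC.summable.mul_of_nonneg hD.summable
      (fun s => by positivity) (fun s => by positivity))
  obtain ⟨X, hX⟩ : ∃ X : (ℕ × ℕ) × G → EllTwo G,
      ∀ p u, X (p, u) = twist (ξ p.1) (ξ' p.2) u :=
    ⟨fun p => twist (ξ p.1.1) (ξ' p.1.2) p.2, fun _ _ => rfl⟩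
  obtain ⟨Y, hY⟩ : ∃ Y : (ℕ × ℕ) × G → EllTwo G,
      ∀ p u, Y (p, u) = twist (η p.1) (η' p.2) u :=
    ⟨fun p => twist (η p.1.1) (η' p.1.2) p.2, fun _ _ => rfl⟩
  have hXY : (Summable fun p => ‖X p‖ * ‖Y p‖) ∧ ∑' p, ‖X p‖ * ‖Y p‖ ≤ C * D := by
    refine summable_fiber (F := fun p => ‖X p‖ * ‖Y p‖) (fun p => by positivity) (fun p => ?_) hCD
    simp only [hX, hY]
    exact summable_norm_twist (ξ p.1) (ξ' p.2) (η p.1) (η' p.2)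
  refine ⟨_, hXY.2, of_index X Y hXY.1.hasSum fun t => ?_⟩
  have h3 := hasSum_mul_coeff (hf t) (hg t) hC.summable hD.summable
    (fun n => norm_coeff_le (ξ n) (η n) t) (fun n => norm_coeff_le (ξ' n) (η' n) t)
  have h4 : Summable fun p => ⟪Y p, leftRegular G t (X p)⟫_ℂ :=
    hXY.1.of_norm_bounded fun p => norm_coeff_le (X p) (Y p) t
  refine hasSum_fiber (F := fun p => ⟪Y p, leftRegular G t (X p)⟫_ℂ) h4 (fun p => ?_) h3
  simp only [hX, hY]
  exact hasSum_inner_twist (ξ p.1) (ξ' p.2) (η p.1) (η' p.2) t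

end FourierBound

/-- The functions in the Fourier algebra, as a subalgebra of all functions `G → ℂ` with pointwise
operations. -/
def fourierAlgebraCarrier (G : Type*) [Group G] : NonUnitalSubalgebra ℂ (G → ℂ) where
  carrier := {f | ∃ C, FourierBound f C}
  add_mem' := fun ⟨_, hf⟩ ⟨_, hg⟩ => ⟨_, hf.add hg⟩
  zero_mem' := ⟨0, FourierBound.zero⟩
  mul_mem' := fun ⟨_, hf⟩ ⟨_, hg⟩ => let ⟨E, _, h⟩ := hf.mul hg; ⟨E, h⟩
  smul_mem' := fun c _ ⟨_, hf⟩ => ⟨_, hf.smul c⟩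

/-- The Fourier algebra `A(G)` of a discrete group `G`: all functions
`t ↦ ∑ₙ ⟨λ(t) ξₙ, ηₙ⟩` with `ξₙ, ηₙ ∈ ℓ²(G)` and `∑ₙ ‖ξₙ‖ ‖ηₙ‖ < ∞`, where `λ` is the left regular
representation, with pointwise operations. It is normed below by the infimum of `∑ₙ ‖ξₙ‖ ‖ηₙ‖` over
all such expressions; this is the norm of the predual of the group von Neumann algebra. -/
def FourierAlgebra (G : Type*) [Group G] : Type _ := fourierAlgebraCarrier G

namespace FourierAlgebra

variable {G : Type*} [Group G]

instance instNonUnitalCommRing : NonUnitalCommRing (FourierAlgebra G) :=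
  NonUnitalSubalgebra.toNonUnitalCommRing (fourierAlgebraCarrier G)

instance : Module ℂ (FourierAlgebra G) :=
  NonUnitalSubalgebra.instModule (S := fourierAlgebraCarrier G)

instance : IsScalarTower ℂ (FourierAlgebra G) (FourierAlgebra G) where
  smul_assoc c f g := Subtype.ext (smul_mul_assoc c f.1 g.1)

instance : SMulCommClass ℂ (FourierAlgebra G) (FourierAlgebra G) where
  smul_comm c f g := Subtype.ext (mul_smul_comm c f.1 g.1).symm

/-- The underlying function on `G`. -/
def toFun (f : FourierAlgebra G) : G → ℂ := Subtype.val (p := (· ∈ fourierAlgebraCarrier G)) f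

noncomputable instance : Norm (FourierAlgebra G) :=
  ⟨fun f => sInf {C : ℝ | FourierBound f.toFun C}⟩

theorem norm_def (f : FourierAlgebra G) : ‖f‖ = sInf {C : ℝ | FourierBound f.toFun C} := rfl

theorem toFun_injective : Function.Injective (toFun : FourierAlgebra G → G → ℂ) :=
  Subtype.val_injective

theorem exists_bound (f : FourierAlgebra G) : {C : ℝ | FourierBound f.toFun C}.Nonempty :=
  Subtype.prop (p := (· ∈ fourierAlgebraCarrier G)) f

theorem norm_le {f : FourierAlgebra G} {C : ℝ} (h : FourierBound f.toFun C) : ‖f‖ ≤ C :=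
  csInf_le ⟨0, fun _ h => h.nonneg⟩ h

theorem exists_lt_add (f : FourierAlgebra G) {ε : ℝ} (hε : 0 < ε) :
    ∃ C, FourierBound f.toFun C ∧ C < ‖f‖ + ε :=
  exists_lt_of_csInf_lt f.exists_bound (lt_add_of_pos_right _ hε)

theorem norm_nonneg' (f : FourierAlgebra G) : 0 ≤ ‖f‖ :=
  Real.sInf_nonneg fun _ h => h.nonneg

theorem norm_apply_le (f : FourierAlgebra G) (t : G) : ‖f.toFun t‖ ≤ ‖f‖ :=
  le_csInf f.exists_bound fun _ h => h.norm_apply_le t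

theorem norm_smul_le' (c : ℂ) (f : FourierAlgebra G) : ‖c • f‖ ≤ ‖c‖ * ‖f‖ := by
  refine le_of_forall_pos_le_add fun ε hε => ?_
  obtain ⟨C, hC, hlt⟩ := f.exists_lt_add (ε := ε / (‖c‖ + 1)) (by positivity)
  refine (norm_le (hC.smul c)).trans ?_
  calc ‖c‖ * C ≤ ‖c‖ * (‖f‖ + ε / (‖c‖ + 1)) := by gcongr
    _ = ‖c‖ * ‖f‖ + ε * (‖c‖ / (‖c‖ + 1)) := by ring
    _ ≤ ‖c‖ * ‖f‖ + ε * 1 := by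
        gcongr
        exact (div_le_one (by positivity)).mpr (by linarith)
    _ = ‖c‖ * ‖f‖ + ε := by ring

noncomputable instance instNormedAddCommGroup : NormedAddCommGroup (FourierAlgebra G) :=
  AddGroupNorm.toNormedAddCommGroup
    { toFun := fun f => ‖f‖
      map_zero' := le_antisymm (norm_le FourierBound.zero) (norm_nonneg' _)
      add_le' := fun f g => by
        refine le_of_forall_pos_le_add fun ε hε => ?_
        obtain ⟨C, hC, hlt⟩ := f.exists_lt_add (half_pos hε)
        obtain ⟨D, hD, hlt'⟩ := g.exists_lt_add (half_pos hε)
        refine (norm_le (f := f + g) (hC.add hD)).trans ?_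
        linarith
      neg' := fun f => by
        have h : ∀ f : FourierAlgebra G, ‖-f‖ ≤ ‖f‖ := fun f => by
          simpa using norm_smul_le' (-1 : ℂ) f
        exact le_antisymm (h f) (by simpa using h (-f))
      eq_zero_of_map_eq_zero' := fun f hf => by
        apply toFun_injective
        funext t
        have h := f.norm_apply_le t
        exact norm_le_zero_iff.mp (h.trans (le_of_eq hf)) }

noncomputable instance : NonUnitalNormedCommRing (FourierAlgebra G) :=
  { instNormedAddCommGroup, instNonUnitalCommRing with
    norm_mul_le := fun f g => by
      have key : ∀ C ∈ {C : ℝ | FourierBound f.toFun C}, ∀ D ∈ {D : ℝ | FourierBound g.toFun D},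
          ‖f * g‖ ≤ C * D := fun C hC D hD =>
        let ⟨E, hE, h⟩ := FourierBound.mul hC hD
        (norm_le (f := f * g) h).trans hE
      have h1 : ∀ C ∈ {C : ℝ | FourierBound f.toFun C}, ‖f * g‖ ≤ C * ‖g‖ := by
        intro C hC
        refine le_of_forall_pos_le_add fun ε hε => ?_
        have hC0 : 0 ≤ C := FourierBound.nonneg hC
        obtain ⟨D, hD, hlt⟩ := g.exists_lt_add (ε := ε / (C + 1)) (by positivity)
        refine (key C hC D hD).trans ?_
        calc C * D ≤ C * (‖g‖ + ε / (C + 1)) := by gcongr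
          _ = C * ‖g‖ + ε * (C / (C + 1)) := by ring
          _ ≤ C * ‖g‖ + ε * 1 := by
              gcongr
              exact (div_le_one (by positivity)).mpr (by linarith)
          _ = C * ‖g‖ + ε := by ring
      refine le_of_forall_pos_le_add fun ε hε => ?_
      have hg0 : 0 ≤ ‖g‖ := norm_nonneg' g
      obtain ⟨C, hC, hlt⟩ := f.exists_lt_add (ε := ε / (‖g‖ + 1)) (by positivity)
      refine (h1 C hC).trans ?_
      calc C * ‖g‖ ≤ (‖f‖ + ε / (‖g‖ + 1)) * ‖g‖ := by gcongr
        _ = ‖f‖ * ‖g‖ + ε * (‖g‖ / (‖g‖ + 1)) := by ring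
        _ ≤ ‖f‖ * ‖g‖ + ε * 1 := by
            gcongr
            exact (div_le_one (by positivity)).mpr (by linarith)
        _ = ‖f‖ * ‖g‖ + ε := by ring }

noncomputable instance : NormedSpace ℂ (FourierAlgebra G) where
  norm_smul_le := norm_smul_le'

end FourierAlgebra

/-- A (complex, not necessarily unital) algebra `A` with a topology is topologically left Noetherian
if every closed left ideal `I` contains finitely many elements `x₁, …, xₙ` with
`I = closure (A♯ x₁ + ⋯ + A♯ xₙ)`. Here `A♯` is the unitisation, so that `A♯ x` consists of the
elements `c x + a x` with `c ∈ ℂ` and `a ∈ A`. (If `A` already has an identity, then this set is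
`A x`, which agrees with the convention `A♯ = A` for unital `A`.) For commutative `A` this is the notion called
"topologically Noetherian". -/
def IsTopologicallyLeftNoetherian (A : Type*) [NonUnitalRing A] [Module ℂ A]
    [TopologicalSpace A] : Prop :=
  ∀ I : Submodule ℂ A, (∀ a : A, ∀ x ∈ I, a * x ∈ I) → IsClosed (I : Set A) →
    ∃ (n : ℕ) (x : Fin n → A), (∀ i, x i ∈ I) ∧
      (I : Set A) = closure {y | ∃ (c : Fin n → ℂ) (a : Fin n → A),
        y = ∑ i, (c i • x i + a i * x i)}

/-! Closed ideals of `A(G)` are controlled by the points where their members do not all vanish,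
through the idempotents `delta t`, for which `delta t * f = f(t) • delta t` (`delta_mul`). If `A(G)`
is topologically Noetherian, it is the closure of a finitely generated ideal. Each generator has
countable support, and at a point outside these supports every element of the closure would vanish,
although `delta t` does not. So the supports cover `G`. Conversely, let `G` be countable and `I` a
closed ideal. Then `delta t ∈ I` whenever some member of `I` is nonzero at `t`, and a weighted sum
`x` of these indicators lies in `I` and is nonzero at all such `t`. For `f ∈ I`, each `delta t * f`
is a multiple of `delta t * x`; as finitely supported functions are dense
(`mem_closure_span_delta`), `A(G)f` lies in the closure of `A(G)x`. The hypothesis that `f` lies in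
the closure of `A(G)f` then shows that the single element `x` generates `I`. -/

theorem EllTwo.countable_support {G : Type*} (ξ : EllTwo G) :
    (Function.support (ξ : G → ℂ)).Countable := by
  refine ξ.hasSum_norm_sq.summable.countable_support.mono fun s hs => ?_
  simpa using hs

namespace FourierAlgebra

variable {G : Type*} [Group G]

/-! ### Evaluations and coefficient functions -/

/-- The element of the Fourier algebra with a given expression as a sum of coefficients. -/
def ofBound (f : G → ℂ) {C : ℝ} (h : FourierBound f C) : FourierAlgebra G :=
  (⟨f, C, h⟩ : fourierAlgebraCarrier G)

theorem toFun_add (f g : FourierAlgebra G) : (f + g).toFun = f.toFun + g.toFun := rfl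

theorem toFun_mul (f g : FourierAlgebra G) : (f * g).toFun = f.toFun * g.toFun := rfl

theorem toFun_smul (c : ℂ) (f : FourierAlgebra G) : (c • f).toFun = c • f.toFun := rfl

/-- Evaluation at a point, as a continuous linear functional. -/
noncomputable def eval (t : G) : FourierAlgebra G →L[ℂ] ℂ :=
  LinearMap.mkContinuous
    { toFun := fun f => f.toFun t
      map_add' := fun _ _ => rfl
      map_smul' := fun _ _ => rfl } 1 (fun f => by rw [one_mul]; exact f.norm_apply_le t)

theorem eval_apply (t : G) (f : FourierAlgebra G) : eval t f = f.toFun t := rfl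

theorem fourierBound_coeff (ξ η : EllTwo G) :
    FourierBound (fun t => ⟪η, leftRegular G t ξ⟫_ℂ) (‖ξ‖ * ‖η‖) :=
  FourierBound.of_index (ι := Unit) (fun _ => ξ) (fun _ => η)
    (hasSum_unique _) (fun _ => hasSum_unique _)

/-- The coefficient function `t ↦ ⟨λ(t) ξ, η⟩`. -/
noncomputable def coeff (ξ η : EllTwo G) : FourierAlgebra G :=
  ofBound _ (fourierBound_coeff ξ η)

theorem coeff_toFun (ξ η : EllTwo G) (t : G) :
    (coeff ξ η).toFun t = ⟪η, leftRegular G t ξ⟫_ℂ := rfl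

theorem norm_coeff_le (ξ η : EllTwo G) : ‖coeff ξ η‖ ≤ ‖ξ‖ * ‖η‖ :=
  norm_le (fourierBound_coeff ξ η)

/-- The coefficient function as a continuous linear function of the first vector. -/
noncomputable def coeffLeft (η : EllTwo G) : EllTwo G →L[ℂ] FourierAlgebra G :=
  LinearMap.mkContinuous
    { toFun := fun ξ => coeff ξ η
      map_add' := fun ξ ξ' => toFun_injective <| funext fun t => by
        simp [toFun_add, coeff_toFun]
      map_smul' := fun c ξ => toFun_injective <| funext fun t => by
        simp [toFun_smul, coeff_toFun] }
    ‖η‖ (fun ξ => (norm_coeff_le ξ η).trans_eq (mul_comm _ _))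

/-- The coefficient function as a continuous conjugate-linear function of the second vector. -/
noncomputable def coeffRight (ξ : EllTwo G) : EllTwo G →L⋆[ℂ] FourierAlgebra G :=
  LinearMap.mkContinuous
    { toFun := fun η => coeff ξ η
      map_add' := fun η η' => toFun_injective <| funext fun t => by
        simp [toFun_add, coeff_toFun]
      map_smul' := fun c η => toFun_injective <| funext fun t => by
        simp [toFun_smul, coeff_toFun, mul_comm] }
    ‖ξ‖ (fun η => norm_coeff_le ξ η)

/-- The partial sums of an absolutely convergent expression of `f` converge to `f` in norm. -/
theorem tendsto_sum_coeff (f : FourierAlgebra G) {C : ℝ} {ξ η : ℕ → EllTwo G}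
    (hC : HasSum (fun n => ‖ξ n‖ * ‖η n‖) C)
    (hf : ∀ t, HasSum (fun n => ⟪η n, leftRegular G t (ξ n)⟫_ℂ) (f.toFun t)) :
    Filter.Tendsto (fun N => ∑ n ∈ Finset.range N, coeff (ξ n) (η n)) Filter.atTop (nhds f) := by
  rw [tendsto_iff_norm_sub_tendsto_zero]
  have h0 : Filter.Tendsto (fun N => C - ∑ n ∈ Finset.range N, ‖ξ n‖ * ‖η n‖)
      Filter.atTop (nhds 0) := by
    simpa using hC.tendsto_sum_nat.const_sub C
  refine squeeze_zero (fun _ => norm_nonneg _) (fun N => ?_) h0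
  rw [norm_sub_rev]
  -- The tail of the expression is itself an expression of the remainder, so the tail of the series
  -- for `C` bounds its norm.
  refine norm_le ⟨fun n => ξ (n + N), fun n => η (n + N), (hasSum_nat_add_iff' N).mpr hC,
    fun t => ?_⟩
  have h := (hasSum_nat_add_iff' N).mpr (hf t)
  convert! h using 1
  rw [← eval_apply, map_sub, map_sum]
  rfl

/-! ### Point indicators and density of finitely supported functions -/

/-- The indicator function of a point. -/
noncomputable def delta (t : G) : FourierAlgebra G := by
  classical exact coeff (lp.single 2 1 1) (lp.single 2 t 1)

theorem inner_single_leftRegular [DecidableEq G] (r s t : G) (a b : ℂ) :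
    ⟪(lp.single 2 r a : EllTwo G), leftRegular G t (lp.single 2 s b)⟫_ℂ =
      if t = r * s⁻¹ then b * star a else 0 := by
  rw [lp.inner_single_left, leftRegular_apply, lp.single_apply]
  by_cases h : t = r * s⁻¹
  · subst h
    simp
  · have h' : t⁻¹ * r ≠ s := by
      rintro rfl
      simp at h
    simp [h, h']

theorem delta_toFun [DecidableEq G] (s t : G) :
    (delta s).toFun t = if t = s then 1 else 0 := by
  classical
  have h := inner_single_leftRegular s 1 t 1 1
  simp only [inv_one, mul_one, star_one] at h
  rw [← h, delta, coeff_toFun]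
  congr!

/-- This turns nonvanishing at `t` of a member of an ideal into membership of `delta t`. -/
theorem delta_mul (t : G) (f : FourierAlgebra G) : delta t * f = f.toFun t • delta t := by
  classical
  refine toFun_injective (funext fun s => ?_)
  by_cases h : s = t <;> simp [toFun_mul, toFun_smul, delta_toFun, h]

theorem coeff_single [DecidableEq G] (r s : G) (a b : ℂ) :
    coeff (lp.single 2 s b) (lp.single 2 r a) = (b * star a) • delta (r * s⁻¹) := by
  refine toFun_injective (funext fun t => ?_)
  rw [coeff_toFun, inner_single_leftRegular, toFun_smul, Pi.smul_apply, delta_toFun]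
  simp

/-- The finitely supported functions are dense in the Fourier algebra. -/
theorem mem_closure_span_delta (f : FourierAlgebra G) :
    f ∈ (Submodule.span ℂ (Set.range (delta (G := G)))).topologicalClosure := by
  classical
  set D := (Submodule.span ℂ (Set.range (delta (G := G)))).topologicalClosure with hD
  have hcl : IsClosed (D : Set (FourierAlgebra G)) := Submodule.isClosed_topologicalClosure _
  have hdelta : ∀ t, delta t ∈ D := fun t =>
    Submodule.le_topologicalClosure _ (Submodule.subset_span ⟨t, rfl⟩)
  have h2 : (2 : ENNReal) ≠ ⊤ := by simp
  -- Truncate one vector at a time: with the first vector a multiple of a basis vector, the finite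
  -- truncations of `η` give combinations of point indicators. Then `hleft` truncates `ξ`.
  have hright : ∀ (s : G) (b : ℂ) (η : EllTwo G), coeff (lp.single 2 s b) η ∈ D := by
    intro s b η
    have h := (lp.hasSum_single h2 η).mapL (coeffRight (lp.single 2 s b))
    refine hcl.mem_of_tendsto h (Filter.Eventually.of_forall fun S => ?_)
    refine D.sum_mem fun r _ => ?_
    change coeff (lp.single 2 s b) (lp.single 2 r (η r)) ∈ D
    rw [coeff_single]
    exact D.smul_mem _ (hdelta _)
  have hleft : ∀ ξ η : EllTwo G, coeff ξ η ∈ D := by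
    intro ξ η
    have h := (lp.hasSum_single h2 ξ).mapL (coeffLeft η)
    exact hcl.mem_of_tendsto h
      (Filter.Eventually.of_forall fun S => D.sum_mem fun s _ => hright s _ η)
  obtain ⟨C, ξ, η, hC, hf⟩ := f.exists_bound
  exact hcl.mem_of_tendsto (tendsto_sum_coeff f hC hf)
    (Filter.Eventually.of_forall fun N => D.sum_mem fun n _ => hleft _ _)

/-! ### Countable supports, and countability of `G` -/

/-- Every function in the Fourier algebra has countable support. -/
theorem countable_support (f : FourierAlgebra G) : (Function.support f.toFun).Countable := by
  obtain ⟨C, ξ, η, -, hf⟩ := f.exists_bound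
  -- A nonzero term of `⟨λ(t) ξₙ, ηₙ⟩` at `r` needs `ηₙ(r) ≠ 0` and `ξₙ(s) ≠ 0` with `s = t⁻¹ r`,
  -- that is, `t = r s⁻¹`.
  have hcount : (⋃ n, Set.image2 (fun r s => r * s⁻¹) (Function.support (η n : G → ℂ))
      (Function.support (ξ n : G → ℂ))).Countable :=
    Set.countable_iUnion fun n =>
      (EllTwo.countable_support _).image2 (EllTwo.countable_support _) _
  refine hcount.mono fun t ht => ?_
  by_contra hnot
  refine ht ((hf t).unique ?_)
  convert! hasSum_zero with n
  refine (lp.hasSum_inner (η n) (leftRegular G t (ξ n))).unique ?_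
  convert! hasSum_zero with r
  by_contra hr
  refine hnot (Set.mem_iUnion.mpr ⟨n, r, ?_, t⁻¹ * r, ?_, by simp⟩)
  · intro h
    exact hr (by simp [h])
  · intro h
    exact hr (by rw [leftRegular_apply, h, inner_zero_right])

theorem countable_of_isTopologicallyLeftNoetherian
    (h : IsTopologicallyLeftNoetherian (FourierAlgebra G)) : Countable G := by
  classical
  obtain ⟨n, x, -, hx⟩ := h ⊤ (fun _ _ _ => trivial) isClosed_univ
  rw [← Set.countable_univ_iff]
  refine (Set.countable_iUnion fun i => (x i).countable_support).mono fun t _ => ?_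
  by_contra ht
  have hxt : ∀ i, (x i).toFun t = 0 := by simpa using ht
  -- Vanishing at `t` is a closed condition, inherited from the generators by the ideal that they
  -- generate.
  have hsub : (Set.univ : Set (FourierAlgebra G)) ⊆ {f | eval t f = 0} := by
    rw [← Submodule.top_coe (R := ℂ), hx]
    refine closure_minimal ?_ (isClosed_eq (eval t).continuous continuous_const)
    rintro _ ⟨c, a, rfl⟩
    change eval t _ = 0
    rw [map_sum]
    exact Finset.sum_eq_zero fun i _ => by
      simp [eval_apply, toFun_add, toFun_mul, toFun_smul, hxt]
  have h1 : eval t (delta t) = 0 := hsub (Set.mem_univ _)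
  simp [eval_apply, delta_toFun] at h1

/-! ### Closed ideals when `G` is countable -/

/-- A closed ideal of the Fourier algebra contains a function which vanishes only where all members
of the ideal vanish, provided that the set of the other points is countable. -/
theorem exists_mem_toFun_ne_zero {I : Submodule ℂ (FourierAlgebra G)}
    (hI : ∀ a : FourierAlgebra G, ∀ x ∈ I, a * x ∈ I)
    (hcl : IsClosed (I : Set (FourierAlgebra G)))
    (hE : {t | ∃ f ∈ I, f.toFun t ≠ 0}.Countable) :
    ∃ x ∈ I, ∀ f ∈ I, ∀ t, f.toFun t ≠ 0 → x.toFun t ≠ 0 := by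
  classical
  rcases Set.eq_empty_or_nonempty {t | ∃ f ∈ I, f.toFun t ≠ 0} with h0 | hne
  · exact ⟨0, I.zero_mem, fun f hf t ht =>
      (Set.eq_empty_iff_forall_notMem.mp h0 t ⟨f, hf, ht⟩).elim⟩
  obtain ⟨e, he⟩ := hE.exists_eq_range hne
  have hdelta : ∀ n, delta (e n) ∈ I := by
    intro n
    obtain ⟨f, hf, hft⟩ : e n ∈ {t | ∃ f ∈ I, f.toFun t ≠ 0} := he ▸ ⟨n, rfl⟩
    have h := hI (delta (e n)) f hf
    rw [delta_mul] at h
    exact (I.smul_mem_iff hft).mp h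
  have hgeo : Summable fun n : ℕ => (1 / 2 : ℝ) ^ n := summable_geometric_two
  have hsum : ∀ t, Summable fun n => if t = e n then (1 / 2 : ℝ) ^ n else 0 := fun t =>
    hgeo.of_nonneg_of_le (fun n => by positivity) (fun n => by split_ifs <;> simp)
  -- These vectors express `x = ∑ₙ 2⁻ⁿ • delta (e n)`. The enumeration `e` may repeat points; the
  -- positive weights rule out cancellation.
  obtain ⟨ξ, hξ⟩ : ∃ ξ : ℕ → EllTwo G, ∀ n, ξ n = lp.single 2 1 ((1 / 2 : ℂ) ^ n) :=
    ⟨_, fun _ => rfl⟩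
  obtain ⟨η, hη⟩ : ∃ η : ℕ → EllTwo G, ∀ n, η n = lp.single 2 (e n) 1 := ⟨_, fun _ => rfl⟩
  have hC : HasSum (fun n => ‖ξ n‖ * ‖η n‖) 2 := by
    convert! hasSum_geometric_two using 2 with n
    rw [hξ, hη, lp.norm_single (by norm_num), lp.norm_single (by norm_num)]
    simp
  have hx : ∀ t, HasSum (fun n => ⟪η n, leftRegular G t (ξ n)⟫_ℂ)
      ((∑' n, if t = e n then (1 / 2 : ℝ) ^ n else 0 : ℝ) : ℂ) := by
    intro t
    convert! Complex.hasSum_ofReal.mpr (hsum t).hasSum using 2 with n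
    rw [hξ, hη, inner_single_leftRegular]
    split_ifs <;> simp_all
  refine ⟨ofBound _ ⟨ξ, η, hC, hx⟩, ?_, fun f hf t ht => ?_⟩
  · refine hcl.mem_of_tendsto (tendsto_sum_coeff (ofBound _ _) hC hx)
      (Filter.Eventually.of_forall fun N => I.sum_mem fun n _ => ?_)
    rw [hξ, hη, coeff_single, inv_one, mul_one]
    exact I.smul_mem _ (hdelta n)
  · obtain ⟨n, rfl⟩ : t ∈ Set.range e := he ▸ ⟨f, hf, ht⟩
    refine Complex.ofReal_ne_zero.mpr ?_
    refine ((hsum _).tsum_pos (fun m => by positivity) n ?_).ne'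
    simp

theorem isTopologicallyLeftNoetherian_of_countable [Countable G]
    (hG : ∀ f : FourierAlgebra G, f ∈ closure (Set.range fun a : FourierAlgebra G => a * f)) :
    IsTopologicallyLeftNoetherian (FourierAlgebra G) := by
  intro I hI hcl
  obtain ⟨x, hxI, hx⟩ := exists_mem_toFun_ne_zero hI hcl (Set.to_countable _)
  refine ⟨1, fun _ => x, fun _ => hxI, Set.Subset.antisymm (fun f hf => ?_) ?_⟩
  · set R : Submodule ℂ (FourierAlgebra G) := LinearMap.range (LinearMap.mulRight ℂ x) with hR
    have hmul : ∀ a : FourierAlgebra G, a * f ∈ R.topologicalClosure := by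
      -- Multiplication by `f` is continuous, so by density only `a = delta t` needs checking.
      have hle : (Submodule.span ℂ (Set.range (delta (G := G)))).topologicalClosure ≤
          R.topologicalClosure.comap (LinearMap.mulRight ℂ f) := by
        refine Submodule.topologicalClosure_minimal _ (Submodule.span_le.mpr ?_)
          (R.isClosed_topologicalClosure.preimage (continuous_mul_const f))
        rintro _ ⟨t, rfl⟩
        change delta t * f ∈ R.topologicalClosure
        rw [delta_mul]
        by_cases ht : f.toFun t = 0
        · rw [ht, zero_smul]
          exact Submodule.zero_mem _
        -- Since `x(t) ≠ 0`, `delta t = (x(t)⁻¹ • delta t) * x` lies in `A(G)x`.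
        refine Submodule.smul_mem _ _ (R.le_topologicalClosure
          ⟨(x.toFun t)⁻¹ • delta t, ?_⟩)
        rw [LinearMap.mulRight_apply, smul_mul_assoc, delta_mul, inv_smul_smul₀ (hx f hf t ht)]
      exact fun a => hle (mem_closure_span_delta a)
    have hfR : f ∈ R.topologicalClosure :=
      closure_minimal (Set.range_subset_iff.mpr hmul) R.isClosed_topologicalClosure (hG f)
    refine closure_mono ?_ hfR
    rintro _ ⟨a, rfl⟩
    -- The scalar part of the unitisation is not needed: `A(G)x` is already dense in `I`.
    exact ⟨0, fun _ => a, by simp⟩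
  · refine closure_minimal ?_ hcl
    rintro _ ⟨c, a, rfl⟩
    exact I.sum_mem fun i _ => I.add_mem (I.smul_mem _ hxI) (hI _ _ hxI)

end FourierAlgebra

theorem proposition2p1 {G : Type*} [Group G]
    (hG : ∀ f : FourierAlgebra G,
      f ∈ closure (Set.range fun a : FourierAlgebra G => a * f)) :
    IsTopologicallyLeftNoetherian (FourierAlgebra G) ↔ Countable G :=
  ⟨FourierAlgebra.countable_of_isTopologicallyLeftNoetherian,
    fun _ => FourierAlgebra.isTopologicallyLeftNoetherian_of_countable hG⟩
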